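/- Let $k$ be a field, $N\ge 1$, and let $Q_1,\dots,Q_N$ be quivers. Let $Rep_k(Q_m)$ be the category of (not necessarily finite-dimensional) $k$-linear representations of $Q_m$, with the vertexwise tensor product. An $N$-representation $\bar M=(M^{(1)},\dots,M^{(N)},\psi_1,\dots,\psi_{N-1})$ of $(Q_1,\dots,Q_N)$ consists of representations $M^{(m)}$ of $Q_m$ and, for each $1\le m<N$, a family $\psi_m$ of $k$-linear maps $\psi_{m}^{\gamma,\delta}\colon M^{(m)}_{t(\gamma)}\to M^{(m+1)}_{s(\delta)}$, one for each pair of arrows $\gamma$ of $Q_m$ and $\delta$ of $Q_{m+1}$. A morphism is a tuple of morphisms of representations that commutes with these maps. The category $Rep_{(Q_1,\dots,Q_N)}$ of $N$-representations is monoidal with the componentwise tensor product $(V^{(m)},\psi_m)\otimes(W^{(m)},\chi_m)=(V^{(m)}\otimes W^{(m)},\psi_m\otimes\chi_m)$. Write $CoAlg(\mathcal C)$ for the category of (coassociative, counital) coalgebras in a monoidal category $\mathcal C$. For a forgetful functor $U\colon\mathcal A\to\mathcal X$, a cofree object over $X\in\mathcal X$ is an object $A$ of $\mathcal A$ with a morphism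 $p\colon UA\to X$ such that every morphism $f\colon UB\to X$, with $B$ in $\mathcal A$, equals $p\circ U(g)$ for exactly one morphism $g\colon B\to A$ of $\mathcal A$. For each $m$ the forgetful functor $\mathcal U_m\colon CoAlg(Rep_k(Q_m))\to Rep_k(Q_m)$ has a right adjoint. Let $\mathcal V_m$ be any right adjoint of $\mathcal U_m$, with counit $\varepsilon^{(m)}\colon\mathcal U_m\mathcal V_m\to\mathrm{id}$, and let $\bar M=(M^{(1)},\dots,M^{(N)},\psi_1,\dots,\psi_{N-1})$ be an $N$-representation. Then there are unique families of $k$-linear maps $\psi'_1,\dots,\psi'_{N-1}$ for which (i) the comultiplications and the counits of the coalgebras $\mathcal V_m(M^{(m)})$ make $(\mathcal V_1(M^{(1)}),\dots,\mathcal V_N(M^{(N)}),\psi'_1,\dots,\psi'_{N-1})$ a coalgebra in $Rep_{(Q_1,\dots,Q_N)}$, and (ii) $\bar\varepsilon=(\varepsilon^{(1)}_{M^{(1)}},\dots,\varepsilon^{(N)}_{M^{(N)}})$ is a morphism of $N$-representations from it to $\bar M$. With these maps, $(\mathcal V_1(M^{(1)}),\dots,\mathcal V_N(M^{(N)}),\psi'_1,\dots,\psi'_{N-1})$,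 together with $\bar\varepsilon$, is the cofree object over $\bar M$ for the forgetful functor $CoAlg(Rep_{(Q_1,\dots,Q_N)})\to Rep_{(Q_1,\dots,Q_N)}$. -/

import Mathlib

open CategoryTheory MonoidalCategory ComonObj

universe u v w

namespace NRepresentations

/-- The category `Rep_k(Q)` of `k`-linear representations of a quiver `Q`: a vector space for
each vertex and a linear map for each arrow, that is, a functor from the free category on `Q`
(see `CategoryTheory.Paths.lift`). Its morphisms are the families of linear maps which commute
with the maps of the representations. It carries the vertexwise tensor product over `k`; the
unit is `k` at each vertex and the identity along each arrow. -/
abbrev QRep (k : Type u) [Field k] (Q : Type v) [Quiver.{w} Q] :=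
  Paths Q ⥤ ModuleCat.{u} k

section

variable {k : Type u} [Field k] {n : ℕ} {Q : Fin (n + 1) → Type v} [∀ m, Quiver.{w} (Q m)]

/-- The space of a representation at a vertex. -/
abbrev QRep.at {Q : Type v} [Quiver.{w} Q] (R : QRep k Q) (i : Q) : ModuleCat.{u} k :=
  R.obj ((Paths.of Q).obj i)

/-- The component at a vertex of a morphism of representations. -/
abbrev QRep.homAt {Q : Type v} [Quiver.{w} Q] {R S : QRep k Q} (f : R ⟶ S) (i : Q) :
    R.at i ⟶ S.at i :=
  f.app ((Paths.of Q).obj i)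

/-- Connecting maps for a tuple of representations: for any two consecutive quivers, a linear
map `R_{t(α)} ⟶ R'_{s(β)}` for each pair of arrows `α : a ⟶ b` of the first quiver and
`β : c ⟶ d` of the second one. -/
abbrev Conn (R : ∀ m, QRep k (Q m)) :=
  ∀ (m : Fin n) ⦃a b : Q m.castSucc⦄ (_ : a ⟶ b) ⦃c d : Q m.succ⦄ (_ : c ⟶ d),
    (R m.castSucc).at b ⟶ (R m.succ).at c

/-- A tuple of morphisms of representations commutes with given connecting maps. -/
def Conn.Compatible {R S : ∀ m, QRep k (Q m)} (ψ : Conn R) (χ : Conn S)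
    (f : ∀ m, R m ⟶ S m) : Prop :=
  ∀ (m : Fin n) ⦃a b : Q m.castSucc⦄ (α : a ⟶ b) ⦃c d : Q m.succ⦄ (β : c ⟶ d),
    ψ m α β ≫ QRep.homAt (f m.succ) c = QRep.homAt (f m.castSucc) b ≫ χ m α β

/-- The tensor product `ψ ⊗ χ` of connecting maps. -/
def Conn.tensor {R S : ∀ m, QRep k (Q m)} (ψ : Conn R) (χ : Conn S) :
    Conn (fun m => R m ⊗ S m) :=
  fun m _ _ α _ _ β => ψ m α β ⊗ₘ χ m α β

/-- The connecting maps of the unit: the identity of `k` everywhere. -/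
def Conn.unit : Conn (fun m => 𝟙_ (QRep k (Q m))) :=
  fun _ _ _ _ _ _ _ => 𝟙 (𝟙_ (ModuleCat.{u} k))

end

section

variable {C : Type*} [Category* C] [MonoidalCategory C]

theorem tensor_square {X₁ X₂ X₃ X₄ Y₁ Y₂ Y₃ Y₄ : C} {p : X₁ ⟶ X₂} {f' : X₂ ⟶ X₄} {f : X₁ ⟶ X₃}
    {q : X₃ ⟶ X₄} {p' : Y₁ ⟶ Y₂} {g' : Y₂ ⟶ Y₄} {g : Y₁ ⟶ Y₃} {q' : Y₃ ⟶ Y₄}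
    (h : p ≫ f' = f ≫ q) (h' : p' ≫ g' = g ≫ q') :
    (p ⊗ₘ p') ≫ (f' ⊗ₘ g') = (f ⊗ₘ g) ≫ (q ⊗ₘ q') := by
  rw [tensorHom_comp_tensorHom, tensorHom_comp_tensorHom, h, h']

theorem whiskerLeft_square {X₁ X₂ Y₁ Y₂ Y₃ Y₄ : C} (p : X₁ ⟶ X₂)
    {p' : Y₁ ⟶ Y₂} {g' : Y₂ ⟶ Y₄} {g : Y₁ ⟶ Y₃} {q' : Y₃ ⟶ Y₄} (h' : p' ≫ g' = g ≫ q') :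
    (p ⊗ₘ p') ≫ X₂ ◁ g' = X₁ ◁ g ≫ (p ⊗ₘ q') := by
  rw [← id_tensorHom, ← id_tensorHom]
  exact tensor_square (by rw [Category.comp_id, Category.id_comp]) h'

theorem whiskerRight_square {X₁ X₂ X₃ X₄ Y₁ Y₂ : C} {p : X₁ ⟶ X₂} {f' : X₂ ⟶ X₄} {f : X₁ ⟶ X₃}
    {q : X₃ ⟶ X₄} (p' : Y₁ ⟶ Y₂) (h : p ≫ f' = f ≫ q) :
    (p ⊗ₘ p') ≫ f' ▷ Y₂ = f ▷ Y₁ ≫ (q ⊗ₘ p') := by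
  rw [← tensorHom_id, ← tensorHom_id]
  exact tensor_square h (by rw [Category.comp_id, Category.id_comp])

theorem leftUnitor_square {X Y : C} (p : X ⟶ Y) :
    (𝟙 (𝟙_ C) ⊗ₘ p) ≫ (λ_ Y).hom = (λ_ X).hom ≫ p := by
  rw [id_tensorHom, leftUnitor_naturality]

theorem rightUnitor_square {X Y : C} (p : X ⟶ Y) :
    (p ⊗ₘ 𝟙 (𝟙_ C)) ≫ (ρ_ Y).hom = (ρ_ X).hom ≫ p := by
  rw [tensorHom_id, rightUnitor_naturality]

end

/-- Representations of a tuple of `n + 1` quivers. -/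
structure NRep (k : Type u) [Field k] {n : ℕ} (Q : Fin (n + 1) → Type v)
    [∀ m, Quiver.{w} (Q m)] where
  /-- the component representations -/
  rep : ∀ m, QRep k (Q m)
  /-- the connecting maps -/
  conn : Conn rep

namespace NRep

variable {k : Type u} [Field k] {n : ℕ} {Q : Fin (n + 1) → Type v} [∀ m, Quiver.{w} (Q m)]

/-- Morphisms of `n`-representations. -/
@[ext]
structure Hom (M N : NRep k Q) where
  /-- the components -/
  app : ∀ m, M.rep m ⟶ N.rep m
  comm : M.conn.Compatible N.conn app

instance : Category (NRep k Q) where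
  Hom M N := Hom M N
  id M := ⟨fun m => 𝟙 (M.rep m), fun m a b α c d β => by simp⟩
  comp f g := ⟨fun m => f.app m ≫ g.app m, fun m a b α c d β => by
    have hf := f.comm m α β
    have hg := g.comm m α β
    simp only [NatTrans.comp_app, Category.assoc] at hf hg ⊢
    rw [← hg, reassoc_of% hf]⟩

@[ext]
theorem hom_ext {M N : NRep k Q} {f g : M ⟶ N} (h : ∀ m, f.app m = g.app m) : f = g :=
  Hom.ext (funext h)

@[simp]
theorem id_app (M : NRep k Q) (m : Fin (n + 1)) : Hom.app (𝟙 M) m = 𝟙 (M.rep m) := rfl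

@[simp]
theorem comp_app {L M N : NRep k Q} (f : L ⟶ M) (g : M ⟶ N) (m : Fin (n + 1)) :
    Hom.app (f ≫ g) m = f.app m ≫ g.app m := rfl

/-- An isomorphism from isomorphisms of the components. -/
def isoMk {M N : NRep k Q} (e : ∀ m, M.rep m ≅ N.rep m)
    (h : M.conn.Compatible N.conn fun m => (e m).hom) : M ≅ N where
  hom := ⟨fun m => (e m).hom, h⟩
  inv := ⟨fun m => (e m).inv, fun m a b α c d β => by
    have hm := h m α β
    have h1 := congrArg (fun t => t.app ((Paths.of _).obj b)) (e m.castSucc).inv_hom_id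
    have h2 := congrArg (fun t => t.app ((Paths.of _).obj c)) (e m.succ).hom_inv_id
    simp only [NatTrans.comp_app, NatTrans.id_app] at h1 h2
    calc N.conn m α β ≫ (e m.succ).inv.app _
        = ((e m.castSucc).inv.app _ ≫ (e m.castSucc).hom.app _) ≫ N.conn m α β ≫
            (e m.succ).inv.app _ := by rw [h1, Category.id_comp]
      _ = (e m.castSucc).inv.app _ ≫ (M.conn m α β ≫ (e m.succ).hom.app _) ≫
            (e m.succ).inv.app _ := by rw [hm]; simp only [Category.assoc]
      _ = _ := by rw [Category.assoc, h2, Category.comp_id]⟩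
  hom_inv_id := by ext1 m; exact (e m).hom_inv_id
  inv_hom_id := by ext1 m; exact (e m).inv_hom_id

/-- The tensor product `(V, ψ) ⊗ (W, χ) = (V ⊗ W, ψ ⊗ χ)`, taken componentwise. -/
instance : MonoidalCategoryStruct (NRep k Q) where
  tensorObj M N := ⟨fun m => M.rep m ⊗ N.rep m, M.conn.tensor N.conn⟩
  tensorHom f g := ⟨fun m => f.app m ⊗ₘ g.app m, fun m _ _ α _ _ β =>
    tensor_square (f.comm m α β) (g.comm m α β)⟩
  whiskerLeft M _ _ g := ⟨fun m => M.rep m ◁ g.app m, fun m _ _ α _ _ β =>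
    whiskerLeft_square (M.conn m α β) (g.comm m α β)⟩
  whiskerRight f N := ⟨fun m => f.app m ▷ N.rep m, fun m _ _ α _ _ β =>
    whiskerRight_square (N.conn m α β) (f.comm m α β)⟩
  tensorUnit := ⟨fun m => 𝟙_ (QRep k (Q m)), Conn.unit⟩
  associator L M N := isoMk (fun m => α_ (L.rep m) (M.rep m) (N.rep m))
    fun m _ _ α _ _ β =>
      MonoidalCategory.associator_naturality (L.conn m α β) (M.conn m α β) (N.conn m α β)
  leftUnitor M := isoMk (fun m => λ_ (M.rep m)) fun m _ _ α _ _ β =>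
    leftUnitor_square (M.conn m α β)
  rightUnitor M := isoMk (fun m => ρ_ (M.rep m)) fun m _ _ α _ _ β =>
    rightUnitor_square (M.conn m α β)

instance : MonoidalCategory (NRep k Q) where
  tensorHom_def f g := hom_ext fun m => tensorHom_def (f.app m) (g.app m)
  id_tensorHom_id M N := hom_ext fun m => id_tensorHom_id (M.rep m) (N.rep m)
  tensorHom_comp_tensorHom f₁ f₂ g₁ g₂ := hom_ext fun m =>
    tensorHom_comp_tensorHom (f₁.app m) (f₂.app m) (g₁.app m) (g₂.app m)
  whiskerLeft_id M N := hom_ext fun m => whiskerLeft_id (M.rep m) (N.rep m)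
  id_whiskerRight M N := hom_ext fun m => id_whiskerRight (M.rep m) (N.rep m)
  associator_naturality f g h := hom_ext fun m =>
    associator_naturality (f.app m) (g.app m) (h.app m)
  leftUnitor_naturality f := hom_ext fun m => leftUnitor_naturality (f.app m)
  rightUnitor_naturality f := hom_ext fun m => rightUnitor_naturality (f.app m)
  pentagon K L M N := hom_ext fun m => pentagon (K.rep m) (L.rep m) (M.rep m) (N.rep m)
  triangle M N := hom_ext fun m => triangle (M.rep m) (N.rep m)

/-- For coalgebras `C m` in `Rep_k(Q m)`, the connecting maps `ψ` make the comultiplications and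
the counits of the `C m` morphisms of `n`-representations. -/
structure IsCoalgConn (C : ∀ m, Comon (QRep k (Q m))) (ψ : Conn fun m => (C m).X) : Prop where
  comul : ψ.Compatible (ψ.tensor ψ) fun m => Δ[(C m).X]
  counit : ψ.Compatible Conn.unit fun m => ε[(C m).X]

/-- The coalgebra `(C 0, …, C n, ψ)` in the category of `n`-representations: its comultiplication
and its counit are those of the coalgebras `C m`. -/
def coalg (C : ∀ m, Comon (QRep k (Q m))) (ψ : Conn fun m => (C m).X) (h : IsCoalgConn C ψ) :
    Comon (NRep k Q) :=
  letI X : NRep k Q := ⟨fun m => (C m).X, ψ⟩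
  { X := X
    comon :=
      { counit := (⟨fun m => ε[(C m).X], h.counit⟩ : Hom X (𝟙_ (NRep k Q)))
        comul := (⟨fun m => Δ[(C m).X], h.comul⟩ : Hom X (X ⊗ X))
        counit_comul := hom_ext fun m => counit_comul (C m).X
        comul_counit := hom_ext fun m => comul_counit (C m).X
        comul_assoc := hom_ext fun m => comul_assoc (C m).X } }

end NRep

/-- `(A, p)` is a co-universal arrow from the functor `U` to `X`, that is, `A` is the cofree
object over `X` by means of `p : U A ⟶ X`. -/
def IsCofree {𝒜 : Type*} [Category* 𝒜] {𝒳 : Type*} [Category* 𝒳] (U : 𝒜 ⥤ 𝒳) (X : 𝒳) (A : 𝒜)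
    (p : U.obj A ⟶ X) : Prop :=
  ∀ (B : 𝒜) (f : U.obj B ⟶ X), ∃! g : B ⟶ A, U.map g ≫ p = f

end NRepresentations

/-!
The essential point is that the forgetful functor from coalgebras over a field `k` to vector
spaces has a right adjoint. For a coalgebra `B` and a linear map `f : B → X`, every word
`φ₁ ⋯ φᵣ` of functionals on `X` gives a functional on `B`, the convolution product of the
`φᵢ ∘ f`. Thus each `b : B` has a coefficient function on words (`coeff`), and the coefficient
functions which arise in this way from *some* coalgebra form a vector space (`cofree`), closed
under addition since coalgebras have binary direct sums. Its size is bounded independently of `B`,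
so that no theorem on finite-dimensional subcoalgebras is needed. The coefficient function of `b`
determines the counit of `b` (empty word), the vector `f b` (words of length one), and the image of
`Δ b` under `coeff f ⊗ coeff f` (concatenated words), the last because pairs of words separate the
points of `cofree ⊗ cofree` (`evalTensor_injective`). So `cofree` inherits a coalgebra structure
with a map `proj` to `X`, and every `f` factors through it by its coefficients. The factorization
is unique since the coefficient function of `t : cofree` with respect to `proj` is `t` (`lift_proj`).

Coalgebras in a functor category are functors to coalgebras, so cofree coalgebras of
representations can be formed vertexwise (`isCofree_of_pointwise`). By uniqueness, every right
adjoint `V` is vertexwise cofree (`IsCofree.pointwise`).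

For the connecting maps, the axioms of a coalgebra in the category of tuples of representations
say precisely that each connecting map is a morphism of coalgebras between vertices. Hence
`ψ'` has to be, and can be, the coalgebra morphism `V(M)_b ⟶ V(M')_c` induced by the linear map
`ε ≫ ψ : V(M)_b ⟶ M'_c`. For the universal property, the morphism is found componentwise; it
commutes with the connecting maps because both sides of the square are coalgebra morphisms into a
cofree coalgebra with the same projection (`compatible_of_isCofree`).
-/

noncomputable section

namespace CofreeCoalgebra

open TensorProduct WithConv

variable {k : Type u} [Field k]

/-! ### Separating families of functionals on a tensor product -/

/-- If two families of functionals separate the points of `V` and of `W`, then their products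
separate the points of `V ⊗ W`. -/
theorem eq_zero_of_separating {ι V W : Type*} [AddCommGroup V] [Module k V] [AddCommGroup W]
    [Module k W] (S : ι → Module.Dual k V) (hS : ∀ v, (∀ i, S i v = 0) → v = 0)
    {κ : Type*} (T : κ → Module.Dual k W) (hT : ∀ v, (∀ i, T i v = 0) → v = 0)
    (z : V ⊗[k] W)
    (hz : ∀ i j, LinearMap.mul' k k (TensorProduct.map (S i) (T j) z) = 0) : z = 0 := by
  classical
  let b := Module.Basis.ofVectorSpace k W
  -- Contract `z` with `S i`, in coordinates with respect to a basis of `W`.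
  have key : ∀ (i : ι) (z : V ⊗[k] W), TensorProduct.lid k W ((S i).rTensor W z) =
      Finsupp.linearCombination k b
        ((TensorProduct.equivFinsuppOfBasisRight b z).mapRange (S i) (map_zero _)) := by
    intro i z
    induction z with
    | zero => simp
    | add x y hx hy =>
      rw [map_add, map_add, hx, hy, map_add, Finsupp.mapRange_add (by simp), map_add]
    | tmul x y =>
      have : ((TensorProduct.equivFinsuppOfBasisRight b (x ⊗ₜ y)).mapRange (S i) (map_zero _)) =
          S i x • b.repr y := by
        ext j
        simp [mul_comm]
      rw [this]
      simp
  have key' : ∀ (i : ι) (j : κ) (z : V ⊗[k] W),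
      T j (TensorProduct.lid k W ((S i).rTensor W z)) =
        LinearMap.mul' k k (TensorProduct.map (S i) (T j) z) := by
    intro i j z
    induction z with
    | zero => simp
    | add x y hx hy => simp only [map_add, hx, hy]
    | tmul x y => simp
  have h0 : ∀ i, (TensorProduct.equivFinsuppOfBasisRight b z).mapRange (S i) (map_zero _) = 0 := by
    intro i
    apply b.linearIndependent
    rw [← key, map_zero]
    exact hT _ fun j => by rw [key', hz]
  apply (TensorProduct.equivFinsuppOfBasisRight b).injective
  rw [map_zero]
  ext j
  refine hS _ fun i => ?_
  simpa using DFunLike.congr_fun (h0 i) j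

variable {X : Type u} [AddCommGroup X] [Module k X]

/-! ### Coefficients of a linear map from a coalgebra -/

section

variable {B : Type*} [AddCommGroup B] [Module k B] [Coalgebra k B]

/-- The functional on a coalgebra `B` given by `f : B → X` and a word of functionals on `X`: the
convolution product of the pullbacks of the letters along `f`. -/
def word (f : B →ₗ[k] X) (l : List (Module.Dual k X)) : WithConv (B →ₗ[k] k) :=
  (l.map fun φ => toConv (φ ∘ₗ f)).prod

theorem word_singleton (f : B →ₗ[k] X) (φ : Module.Dual k X) (b : B) :
    word f [φ] b = φ (f b) := by
  simp [word]

theorem word_append (f : B →ₗ[k] X) (l l' : List (Module.Dual k X)) :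
    word f (l ++ l') = word f l * word f l' := by
  simp [word]

theorem word_comp {C : Type*} [AddCommGroup C] [Module k C] [Coalgebra k C] (f : B →ₗ[k] X)
    (h : C →ₗc[k] B) (l : List (Module.Dual k X)) (c : C) :
    word (f ∘ₗ h.toLinearMap) l c = word f l (h c) := by
  suffices word (f ∘ₗ h.toLinearMap) l = toConv ((word f l).ofConv ∘ₗ h.toLinearMap) by
    rw [this]; rfl
  induction l with
  | nil =>
    ext c
    simp [word]
  | cons φ l ih =>
    rw [← List.singleton_append, word_append, word_append,
      LinearMap.convMul_comp_coalgHom_distrib, ih]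
    simp [word, LinearMap.comp_assoc]

/-- The values at `b : B` of all word functionals of `f : B → X`, as a function on words. -/
def coeff (f : B →ₗ[k] X) : B →ₗ[k] (List (Module.Dual k X) → k) :=
  LinearMap.pi fun l => (word f l).ofConv

theorem coeff_comp {C : Type*} [AddCommGroup C] [Module k C] [Coalgebra k C] (f : B →ₗ[k] X)
    (h : C →ₗc[k] B) (c : C) : coeff (f ∘ₗ h.toLinearMap) c = coeff f (h c) :=
  funext fun l => word_comp f h l c

end

section

variable {B C : Type*} [AddCommGroup B] [Module k B] [Coalgebra k B]
  [AddCommGroup C] [Module k C] [Coalgebra k C]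

/-- The left inclusion into a direct sum of coalgebras. -/
def inl : B →ₗc[k] B × C where
  toLinearMap := LinearMap.inl k B C
  counit_comp := by ext; simp
  map_comp_comul := (Prod.comul_comp_inl k B C).symm

/-- The right inclusion into a direct sum of coalgebras. -/
def inr : C →ₗc[k] B × C where
  toLinearMap := LinearMap.inr k B C
  counit_comp := by ext; simp
  map_comp_comul := (Prod.comul_comp_inr k B C).symm

end

/-! ### Coalgebra axioms on the image of a coalgebra -/

section

-- Here `C` only carries the operations of a coalgebra. Its axioms hold at every point in the image
-- of a coalgebra under a map which respects the operations.
variable {B C : Type*} [AddCommGroup B] [Module k B] [Coalgebra k B]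
  [AddCommGroup C] [Module k C] [CoalgebraStruct k C] (g : B →ₗc[k] C)

theorem coassoc_of_coalgHom (b : B) :
    TensorProduct.assoc k C C C (Coalgebra.comul.rTensor C (Coalgebra.comul (g b))) =
      Coalgebra.comul.lTensor C (Coalgebra.comul (R := k) (g b)) := by
  have h1 : ∀ z : B ⊗[k] B, TensorProduct.assoc k C C C
      (Coalgebra.comul.rTensor C (TensorProduct.map g.toLinearMap g.toLinearMap z)) =
      TensorProduct.map g.toLinearMap (TensorProduct.map g.toLinearMap g.toLinearMap)
        (TensorProduct.assoc k _ _ _ (Coalgebra.comul.rTensor B z)) := by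
    intro z
    rw [TensorProduct.map_map_assoc]
    simp only [LinearMap.rTensor, TensorProduct.map_map, g.map_comp_comul, LinearMap.comp_id,
      LinearMap.id_comp]
  have h2 : ∀ z : B ⊗[k] B,
      Coalgebra.comul.lTensor C (TensorProduct.map g.toLinearMap g.toLinearMap z) =
      TensorProduct.map g.toLinearMap (TensorProduct.map g.toLinearMap g.toLinearMap)
        (Coalgebra.comul.lTensor B z) := by
    intro z
    simp only [LinearMap.lTensor, TensorProduct.map_map, g.map_comp_comul, LinearMap.comp_id,
      LinearMap.id_comp]
  rw [← CoalgHomClass.map_comp_comul_apply]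
  exact (h1 _).trans ((congrArg _ (Coalgebra.coassoc_apply b)).trans (h2 _).symm)

theorem rTensor_counit_of_coalgHom (b : B) :
    Coalgebra.counit.rTensor C (Coalgebra.comul (R := k) (g b)) = 1 ⊗ₜ[k] g b := by
  have h : ∀ z : B ⊗[k] B,
      Coalgebra.counit.rTensor C (TensorProduct.map g.toLinearMap g.toLinearMap z) =
        g.toLinearMap.lTensor k (Coalgebra.counit.rTensor B z) := by
    intro z
    simp only [LinearMap.lTensor, LinearMap.rTensor, TensorProduct.map_map, g.counit_comp,
      LinearMap.comp_id, LinearMap.id_comp]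
  rw [← CoalgHomClass.map_comp_comul_apply]
  exact (h _).trans (by rw [Coalgebra.rTensor_counit_comul]; rfl)

theorem lTensor_counit_of_coalgHom (b : B) :
    Coalgebra.counit.lTensor C (Coalgebra.comul (R := k) (g b)) = g b ⊗ₜ[k] 1 := by
  have h : ∀ z : B ⊗[k] B,
      Coalgebra.counit.lTensor C (TensorProduct.map g.toLinearMap g.toLinearMap z) =
        g.toLinearMap.rTensor k (Coalgebra.counit.lTensor B z) := by
    intro z
    simp only [LinearMap.lTensor, LinearMap.rTensor, TensorProduct.map_map, g.counit_comp,
      LinearMap.comp_id, LinearMap.id_comp]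
  rw [← CoalgHomClass.map_comp_comul_apply]
  exact (h _).trans (by rw [Coalgebra.lTensor_counit_comul]; rfl)

end

/-! ### The cofree coalgebra on a vector space -/

variable (k X) in
/-- The cofree coalgebra on `X`, as a space of functions on the words of functionals on `X`: the
coefficient functions of the elements of all coalgebras `B`, for all linear maps `B → X`. Although
`B` ranges over a universe, these functions form a set. -/
def cofree : Submodule k (List (Module.Dual k X) → k) where
  carrier := {t | ∃ (B : Type u) (_ : AddCommGroup B) (_ : Module k B) (_ : Coalgebra k B)
    (f : B →ₗ[k] X) (b : B), coeff f b = t}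
  zero_mem' := ⟨k, inferInstance, inferInstance, inferInstance, 0, 0, map_zero _⟩
  add_mem' := by
    rintro _ _ ⟨B, _, _, _, f, b, rfl⟩ ⟨C, _, _, _, g, c, rfl⟩
    refine ⟨B × C, inferInstance, inferInstance, inferInstance, f.coprod g, (b, c), ?_⟩
    have h1 := coeff_comp (f.coprod g) (inl : B →ₗc[k] B × C) b
    have h2 := coeff_comp (f.coprod g) (inr : C →ₗc[k] B × C) c
    rw [show (f.coprod g) ∘ₗ (inl : B →ₗc[k] B × C).toLinearMap = f from f.coprod_inl g] at h1
    rw [show (f.coprod g) ∘ₗ (inr : C →ₗc[k] B × C).toLinearMap = g from f.coprod_inr g] at h2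
    rw [h1, h2, ← map_add]
    congr 1
    simp [inl, inr]
  smul_mem' := by
    rintro r _ ⟨B, _, _, _, f, b, rfl⟩
    exact ⟨B, _, _, _, f, r • b, map_smul _ _ _⟩

/-- The map to the cofree coalgebra induced by a linear map `f : B → X`. -/
def lift {B : Type u} [AddCommGroup B] [Module k B] [Coalgebra k B] (f : B →ₗ[k] X) :
    B →ₗ[k] cofree k X :=
  (coeff f).codRestrict _ fun b => ⟨B, _, _, _, f, b, rfl⟩

theorem exists_lift (t : cofree k X) :
    ∃ (B : Type u) (_ : AddCommGroup B) (_ : Module k B) (_ : Coalgebra k B)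
      (f : B →ₗ[k] X) (b : B), lift f b = t := by
  obtain ⟨_, B, i1, i2, i3, f, b, rfl⟩ := t
  exact ⟨B, i1, i2, i3, f, b, rfl⟩

/-- Evaluation at a word. -/
def eval (l : List (Module.Dual k X)) : Module.Dual k (cofree k X) :=
  LinearMap.proj l ∘ₗ (cofree k X).subtype

variable (k X) in
/-- Evaluation of the two factors of `cofree k X ⊗ cofree k X` at a pair of words. -/
def evalTensor : cofree k X ⊗[k] cofree k X →ₗ[k]
    (List (Module.Dual k X) × List (Module.Dual k X) → k) :=
  LinearMap.pi fun p => LinearMap.mul' k k ∘ₗ TensorProduct.map (eval p.1) (eval p.2)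

theorem evalTensor_apply (z : cofree k X ⊗[k] cofree k X) (l l' : List (Module.Dual k X)) :
    evalTensor k X z (l, l') = LinearMap.mul' k k (TensorProduct.map (eval l) (eval l') z) := rfl

theorem eq_zero_of_eval (t : cofree k X) (h : ∀ l, eval l t = 0) : t = 0 :=
  Subtype.ext (funext h)

theorem evalTensor_injective : Function.Injective (evalTensor k X) := by
  rw [injective_iff_map_eq_zero]
  intro z hz
  refine eq_zero_of_separating eval eq_zero_of_eval eval eq_zero_of_eval z fun l l' => ?_
  rw [← evalTensor_apply, hz, Pi.zero_apply]

variable (k X) in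
/-- Evaluation at the concatenation of a pair of words. -/
def concat : cofree k X →ₗ[k] (List (Module.Dual k X) × List (Module.Dual k X) → k) :=
  LinearMap.pi fun p => eval (p.1 ++ p.2)

/-- Concatenation of words corresponds to convolution of functionals, hence to the
comultiplication of `B`. -/
theorem evalTensor_map_lift {B : Type u} [AddCommGroup B] [Module k B] [Coalgebra k B]
    (f : B →ₗ[k] X) (b : B) :
    evalTensor k X (TensorProduct.map (lift f) (lift f) (Coalgebra.comul b)) =
      concat k X (lift f b) := by
  funext ⟨l, l'⟩
  change LinearMap.mul' k k (TensorProduct.map (eval l) (eval l') (TensorProduct.map _ _ _)) =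
    word f (l ++ l') b
  rw [word_append, LinearMap.convMul_apply, TensorProduct.map_map]
  rfl

variable (k X) in
/-- The comultiplication: `comulMap k X t` is the only tensor whose value at each pair of words is
the value of `t` at their concatenation. -/
def comulMap : cofree k X →ₗ[k] cofree k X ⊗[k] cofree k X :=
  (concat k X).codRestrictOfInjective (evalTensor k X) evalTensor_injective fun t => by
    obtain ⟨B, _, _, _, f, b, rfl⟩ := exists_lift t
    exact ⟨_, evalTensor_map_lift f b⟩

theorem comul_lift {B : Type u} [AddCommGroup B] [Module k B] [Coalgebra k B]
    (f : B →ₗ[k] X) (b : B) :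
    comulMap k X (lift f b) = TensorProduct.map (lift f) (lift f) (Coalgebra.comul b) := by
  apply evalTensor_injective
  rw [evalTensor_map_lift]
  exact LinearMap.codRestrictOfInjective_comp_apply ..

instance : CoalgebraStruct k (cofree k X) where
  comul := comulMap k X
  counit := eval []

/-- The morphism of coalgebras to the cofree coalgebra induced by a linear map `f : B → X`. -/
def liftHom {B : Type u} [AddCommGroup B] [Module k B] [Coalgebra k B] (f : B →ₗ[k] X) :
    B →ₗc[k] cofree k X where
  toLinearMap := lift f
  counit_comp := rfl
  map_comp_comul := LinearMap.ext fun b => (comul_lift f b).symm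

theorem exists_liftHom (t : cofree k X) :
    ∃ (B : Type u) (_ : AddCommGroup B) (_ : Module k B) (_ : Coalgebra k B)
      (f : B →ₗ[k] X) (b : B), liftHom f b = t :=
  exists_lift t

instance : Coalgebra k (cofree k X) where
  coassoc := LinearMap.ext fun t => by
    obtain ⟨B, _, _, _, f, b, rfl⟩ := exists_liftHom t
    exact coassoc_of_coalgHom (liftHom f) b
  rTensor_counit_comp_comul := LinearMap.ext fun t => by
    obtain ⟨B, _, _, _, f, b, rfl⟩ := exists_liftHom t
    exact rTensor_counit_of_coalgHom (liftHom f) b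
  lTensor_counit_comp_comul := LinearMap.ext fun t => by
    obtain ⟨B, _, _, _, f, b, rfl⟩ := exists_liftHom t
    exact lTensor_counit_of_coalgHom (liftHom f) b

variable (k X) in
/-- The canonical map from `X` to the functions on its dual space. -/
def evalDual : X →ₗ[k] (Module.Dual k X → k) := LinearMap.pi fun φ => φ

theorem evalDual_injective : Function.Injective (evalDual k X) := by
  rw [injective_iff_map_eq_zero]
  intro x hx
  exact (Module.forall_dual_apply_eq_zero_iff k x).1 fun φ => congrFun hx φ

variable (k X) in
/-- The projection of the cofree coalgebra on `X` to `X`: the vector `proj k X t` is the one on which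
each functional `φ` takes the value of `t` at the word `φ` of length one. -/
def proj : cofree k X →ₗ[k] X :=
  (LinearMap.pi fun φ => eval [φ]).codRestrictOfInjective (evalDual k X) evalDual_injective
    fun t => by
      obtain ⟨B, _, _, _, f, b, rfl⟩ := exists_lift t
      exact ⟨f b, funext fun φ => (word_singleton f φ b).symm⟩

theorem proj_lift {B : Type u} [AddCommGroup B] [Module k B] [Coalgebra k B] (f : B →ₗ[k] X)
    (b : B) : proj k X (lift f b) = f b := by
  apply evalDual_injective (k := k)
  refine (LinearMap.codRestrictOfInjective_comp_apply ..).trans ?_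
  exact funext fun φ => word_singleton f φ b

/-- An element of the cofree coalgebra is its own coefficient function with respect to the
projection. This gives the uniqueness of lifts. -/
theorem lift_proj (t : cofree k X) : lift (proj k X) t = t := by
  obtain ⟨B, _, _, _, f, b, rfl⟩ := exists_lift t
  apply Subtype.ext
  change coeff (proj k X) (liftHom f b) = coeff f b
  rw [← coeff_comp]
  congr 2
  exact LinearMap.ext (proj_lift f)

theorem eq_lift {B : Type u} [AddCommGroup B] [Module k B] [Coalgebra k B]
    (g : B →ₗc[k] cofree k X) : g.toLinearMap = lift (proj k X ∘ₗ g.toLinearMap) := by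
  ext1 b
  apply Subtype.ext
  change _ = coeff (proj k X ∘ₗ g.toLinearMap) b
  rw [coeff_comp]
  exact (congrArg Subtype.val (lift_proj (g b))).symm

end CofreeCoalgebra

namespace NRepresentations

/-! ### Cofree objects and adjunctions -/

section

variable {𝒜 : Type*} [Category* 𝒜] {𝒳 : Type*} [Category* 𝒳] {U : 𝒜 ⥤ 𝒳}

theorem isCofree_of_adjunction {V : 𝒳 ⥤ 𝒜} (adj : U ⊣ V) (X : 𝒳) :
    IsCofree U X (V.obj X) (adj.counit.app X) := fun B f =>
  ⟨adj.homEquiv B X f, by simp [Adjunction.homEquiv_unit], fun g hg => by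
    rw [← hg, ← Adjunction.homEquiv_counit, Equiv.apply_symm_apply]⟩

theorem IsCofree.hom_ext {X : 𝒳} {A : 𝒜} {p : U.obj A ⟶ X} (h : IsCofree U X A p) {B : 𝒜}
    {g g' : B ⟶ A} (hg : U.map g ≫ p = U.map g' ≫ p) : g = g' :=
  (h B (U.map g' ≫ p)).unique hg rfl

/-- With `p : Z ⟶ Z'` and `q : W ⟶ X` read as projections: if `w` lies over `t`, and `x ≫ y` has the
same projection as `v` followed by `t`, then `x ≫ y` and `v ≫ w` have the same projection. -/
theorem comp_eq_comp_of_squares {V W X Y Z Z' : 𝒳} {x : V ⟶ Y} {y : Y ⟶ Z} {p : Z ⟶ Z'}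
    {v : V ⟶ W} {w : W ⟶ Z} {q : W ⟶ X} {t : X ⟶ Z'} (h : x ≫ y ≫ p = (v ≫ q) ≫ t) (h' : w ≫ p = q ≫ t) :
    (x ≫ y) ≫ p = (v ≫ w) ≫ p := by
  rw [Category.assoc, h, Category.assoc, Category.assoc, h']

theorem isLeftAdjoint_of_isCofree
    (h : ∀ X : 𝒳, ∃ (A : 𝒜) (p : U.obj A ⟶ X), IsCofree U X A p) : U.IsLeftAdjoint := by
  have : ∀ X, Limits.HasTerminal (CostructuredArrow U X) := fun X => by
    obtain ⟨A, p, hA⟩ := h X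
    refine Limits.IsTerminal.hasTerminal (X := CostructuredArrow.mk p)
      (Limits.IsTerminal.ofUniqueHom (fun B => CostructuredArrow.homMk (hA B.left B.hom).choose
        (hA B.left B.hom).choose_spec.1) fun B g => ?_)
    ext
    exact (hA B.left B.hom).choose_spec.2 _ (CostructuredArrow.w g)
  exact isLeftAdjoint_of_costructuredArrowTerminals U

theorem IsCofree.exists_iso {X : 𝒳} {A A' : 𝒜} {p : U.obj A ⟶ X} {p' : U.obj A' ⟶ X}
    (h : IsCofree U X A p) (h' : IsCofree U X A' p') : ∃ e : A ≅ A', U.map e.hom ≫ p' = p := by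
  obtain ⟨f, hf, -⟩ := h' A p
  obtain ⟨g, hg, -⟩ := h A' p'
  exact ⟨⟨f, g, h.hom_ext (by simp [hf, hg]), h'.hom_ext (by simp [hf, hg])⟩, hf⟩

theorem IsCofree.of_iso {X : 𝒳} {A A' : 𝒜} {p : U.obj A ⟶ X} {p' : U.obj A' ⟶ X}
    (h' : IsCofree U X A' p') (e : A ≅ A') (he : U.map e.hom ≫ p' = p) :
    IsCofree U X A p := fun B f => by
  obtain ⟨g, hg, hu⟩ := h' B f
  refine ⟨g ≫ e.inv, ?_, fun g₁ hg₁ => ?_⟩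
  · dsimp only
    rw [← he, ← Functor.map_comp_assoc, Category.assoc, e.inv_hom_id, Category.comp_id, hg]
  · rw [← hu (g₁ ≫ e.hom) (by simpa [he] using hg₁), Category.assoc,
      e.hom_inv_id, Category.comp_id]

end

/-! ### Coalgebras in a category of representations -/

theorem isCofree_cofree {k : Type u} [Field k] (X : ModuleCat.{u} k) :
    IsCofree (Comon.forget (ModuleCat.{u} k)) X
      ((CoalgCat.toComon k).obj (CoalgCat.of k (CofreeCoalgebra.cofree k X)))
      (ModuleCat.ofHom (CofreeCoalgebra.proj k X)) := fun B (f : B.X ⟶ X) => by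
  let _ : Coalgebra k B.X := (CoalgCat.ofComonObj B.X).instCoalgebra
  refine ⟨(CoalgCat.toComon k).map (X := CoalgCat.ofComonObj B.X)
    (CoalgCat.ofHom (CofreeCoalgebra.liftHom f.hom)), ?_, fun g hg => ?_⟩
  · exact ModuleCat.hom_ext (LinearMap.ext fun b => CofreeCoalgebra.proj_lift (B := B.X) f.hom b)
  · subst hg
    refine Comon.Hom.ext (ModuleCat.hom_ext ?_)
    exact CofreeCoalgebra.eq_lift ((CoalgCat.ofComon k).map g).1

instance (k : Type u) [Field k] : (Comon.forget (ModuleCat.{u} k)).IsLeftAdjoint :=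
  isLeftAdjoint_of_isCofree fun X => ⟨_, _, isCofree_cofree X⟩

section

open Monoidal.ComonFunctorCategoryEquivalence

variable {C : Type*} [Category* C] {D : Type*} [Category* D] [MonoidalCategory D]

/-- A functor `A` to comonoids over `M` which is cofree at each object is cofree over `M`, when
regarded as a comonoid in the functor category. -/
theorem isCofree_of_pointwise {M : C ⥤ D} (A : C ⥤ Comon D) (p : A ⋙ Comon.forget D ⟶ M)
    (h : ∀ c, IsCofree (Comon.forget D) (M.obj c) (A.obj c) (p.app c)) :
    IsCofree (Comon.forget (C ⥤ D)) M (inverseObj A) p := fun B f => by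
  choose g hg hu using fun c => h c (functorObjObj B.X c) (f.app c)
  -- By uniqueness, the morphisms induced at each object are natural.
  have nat : ∀ {c d : C} (φ : c ⟶ d), (functorObj B.X).map φ ≫ g d = g c ≫ A.map φ := by
    intro c d φ
    refine (h d).hom_ext (comp_eq_comp_of_squares ?_ (p.naturality φ))
    exact (congrArg (B.X.map φ ≫ ·) (hg d)).trans
      ((f.naturality φ).trans (congrArg (· ≫ M.map φ) (hg c).symm))
  refine ⟨Comon.Hom.mk' (M := B) (N := inverseObj A)
    { app := fun c => (g c).hom
      naturality := fun _ _ φ => congrArg Comon.Hom.hom (nat φ) } ?_ ?_, ?_, ?_⟩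
  · ext c; exact IsComonHom.hom_counit (g c).hom
  · ext c; exact IsComonHom.hom_comul (g c).hom
  · ext c; exact hg c
  · intro g' hg'
    ext c
    exact congrArg Comon.Hom.hom (hu c (((functor).map g').app c) (congr_app hg' c))

theorem exists_isCofree [(Comon.forget D).IsLeftAdjoint] (M : C ⥤ D) :
    ∃ (A : Comon (C ⥤ D)) (p : A.X ⟶ M), IsCofree (Comon.forget (C ⥤ D)) M A p ∧
      ∀ c, IsCofree (Comon.forget D) (M.obj c) (functorObjObj A.X c) (p.app c) := by
  let adj := Adjunction.ofIsLeftAdjoint (Comon.forget D)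
  let A := M ⋙ (Comon.forget D).rightAdjoint
  let p : A ⋙ Comon.forget D ⟶ M := Functor.whiskerLeft M adj.counit
  have h : ∀ c, IsCofree (Comon.forget D) (M.obj c) (A.obj c) (p.app c) :=
    fun c => isCofree_of_adjunction adj (M.obj c)
  exact ⟨inverseObj A, p, isCofree_of_pointwise A p h, h⟩

/-- Cofree comonoids in a functor category are pointwise cofree: this holds for the one formed
pointwise, and a cofree object is unique up to isomorphism. -/
theorem IsCofree.pointwise [(Comon.forget D).IsLeftAdjoint] {M : C ⥤ D} {A : Comon (C ⥤ D)}
    {p : A.X ⟶ M} (h : IsCofree (Comon.forget (C ⥤ D)) M A p) (c : C) :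
    IsCofree (Comon.forget D) (M.obj c) (functorObjObj A.X c) (p.app c) := by
  obtain ⟨A', p', h', hc⟩ := exists_isCofree M
  obtain ⟨e, he⟩ := h.exists_iso h'
  exact (hc c).of_iso ((functor.mapIso e).app c) (congr_app he c)

end

/-! ### Coalgebras in the category of tuples of representations -/

section

open Monoidal.ComonFunctorCategoryEquivalence

variable {k : Type u} [Field k] {n : ℕ} {Q : Fin (n + 1) → Type v} [∀ m, Quiver.{w} (Q m)]

/-- The coalgebra at a vertex of a coalgebra in `Rep_k(Q)`. -/
abbrev coalgAt {Q : Type v} [Quiver.{w} Q] (C : Comon (QRep k Q)) (i : Q) :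
    Comon (ModuleCat.{u} k) :=
  functorObjObj C.X ((Paths.of Q).obj i)

/-- The component at a vertex of a morphism of coalgebras in `Rep_k(Q)`. -/
abbrev homCoalgAt {Q : Type v} [Quiver.{w} Q] {C D : Comon (QRep k Q)} (f : C ⟶ D) (i : Q) :
    coalgAt C i ⟶ coalgAt D i :=
  (functor.map f).app ((Paths.of Q).obj i)

namespace NRep

/-- A connecting map of a coalgebra, as a morphism between the coalgebras at two vertices. -/
abbrev IsCoalgConn.hom {C : ∀ m, Comon (QRep k (Q m))} {ψ : Conn fun m => (C m).X}
    (h : IsCoalgConn C ψ) (m : Fin n) {a b : Q m.castSucc} (α : a ⟶ b) {c d : Q m.succ}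
    (β : c ⟶ d) : coalgAt (C m.castSucc) b ⟶ coalgAt (C m.succ) c :=
  Comon.Hom.mk' (ψ m α β) (h.counit m α β) (h.comul m α β)

/-- The coalgebra in `Rep_k(Q m)` underlying a coalgebra of tuples of representations. -/
def component (B : Comon (NRep k Q)) (m : Fin (n + 1)) : Comon (QRep k (Q m)) where
  X := B.X.rep m
  comon :=
    { counit := Hom.app ε[B.X] m
      comul := Hom.app Δ[B.X] m
      counit_comul := congrArg (fun f => Hom.app f m) (counit_comul B.X)
      comul_counit := congrArg (fun f => Hom.app f m) (comul_counit B.X)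
      comul_assoc := congrArg (fun f => Hom.app f m) (comul_assoc B.X) }

theorem isCoalgConn_component (B : Comon (NRep k Q)) : IsCoalgConn (component B) B.X.conn where
  comul := Hom.comm Δ[B.X]
  counit := Hom.comm ε[B.X]

/-- The components of a morphism of coalgebras of tuples of representations. -/
def homComponent {B B' : Comon (NRep k Q)} (g : B ⟶ B') (m : Fin (n + 1)) :
    component B m ⟶ component B' m :=
  Comon.Hom.mk' (g.hom.app m) (congrArg (fun f => Hom.app f m) (IsComonHom.hom_counit g.hom))
    (congrArg (fun f => Hom.app f m) (IsComonHom.hom_comul g.hom))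

end NRep

open NRep

variable {M : NRep k Q} {C : ∀ m, Comon (QRep k (Q m))} {p : ∀ m, (C m).X ⟶ M.rep m}

/-- If the `C m` are cofree at each vertex, then the connecting maps of `M` lift to them. -/
theorem exists_conn (h : ∀ m i, IsCofree (Comon.forget (ModuleCat.{u} k)) ((M.rep m).at i)
      (coalgAt (C m) i) (QRep.homAt (p m) i)) :
    ∃ ψ : Conn fun m => (C m).X, IsCoalgConn C ψ ∧ ψ.Compatible M.conn p := by
  choose g hg _ using fun (m : Fin n) (a b : Q m.castSucc) (α : a ⟶ b) (c d : Q m.succ)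
    (β : c ⟶ d) => h m.succ c (coalgAt (C m.castSucc) b)
      (QRep.homAt (p m.castSucc) b ≫ M.conn m α β)
  exact ⟨fun m a b α c d β => (g m a b α c d β).hom,
    ⟨fun m a b α c d β => IsComonHom.hom_comul (g m a b α c d β).hom,
      fun m a b α c d β => IsComonHom.hom_counit (g m a b α c d β).hom⟩, hg⟩

theorem conn_unique (h : ∀ m i, IsCofree (Comon.forget (ModuleCat.{u} k)) ((M.rep m).at i)
      (coalgAt (C m) i) (QRep.homAt (p m) i)) {ψ χ : Conn fun m => (C m).X}
    (hψ : IsCoalgConn C ψ) (hψp : ψ.Compatible M.conn p)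
    (hχ : IsCoalgConn C χ) (hχp : χ.Compatible M.conn p) : χ = ψ := by
  funext m a b α c d β
  exact congrArg Comon.Hom.hom ((h m.succ c).hom_ext (g := hχ.hom m α β) (g' := hψ.hom m α β)
    ((hχp m α β).trans (hψp m α β).symm))

/-- Morphisms into coalgebras which are cofree at each vertex commute with the connecting maps if
their composites with the projections do. -/
theorem compatible_of_isCofree (h : ∀ m i, IsCofree (Comon.forget (ModuleCat.{u} k))
      ((M.rep m).at i) (coalgAt (C m) i) (QRep.homAt (p m) i)) {ψ : Conn fun m => (C m).X}
    (hψ : IsCoalgConn C ψ) (hψp : ψ.Compatible M.conn p)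
    {B : ∀ m, Comon (QRep k (Q m))} {χ : Conn fun m => (B m).X} (hχ : IsCoalgConn B χ)
    (g : ∀ m, B m ⟶ C m) (hg : χ.Compatible M.conn fun m => (g m).hom ≫ p m) :
    χ.Compatible ψ fun m => (g m).hom := by
  intro m a b α c d β
  refine congrArg Comon.Hom.hom ((h m.succ c).hom_ext
    (g := hχ.hom m α β ≫ homCoalgAt (g m.succ) c)
    (g' := homCoalgAt (g m.castSucc) b ≫ hψ.hom m α β) ?_)
  exact comp_eq_comp_of_squares (hg m α β) (hψp m α β)

theorem isCofree_coalg (h₁ : ∀ m, IsCofree (Comon.forget (QRep k (Q m))) (M.rep m) (C m) (p m))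
    (h : ∀ m i, IsCofree (Comon.forget (ModuleCat.{u} k))
      ((M.rep m).at i) (coalgAt (C m) i) (QRep.homAt (p m) i)) {ψ : Conn fun m => (C m).X}
    (hψ : IsCoalgConn C ψ) (hψp : ψ.Compatible M.conn p) :
    IsCofree (Comon.forget (NRep k Q)) M (coalg C ψ hψ) ⟨p, hψp⟩ := fun B f => by
  choose g hg hu using fun m => h₁ m (component B m) (f.app m)
  have hc : B.X.conn.Compatible ψ fun m => (g m).hom :=
    compatible_of_isCofree h hψ hψp (isCoalgConn_component B) g (by
      have := f.comm
      rwa [← funext hg] at this)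
  refine ⟨Comon.Hom.mk' (⟨fun m => (g m).hom, hc⟩ : Hom B.X (coalg C ψ hψ).X) ?_ ?_, ?_, ?_⟩
  · exact NRep.hom_ext fun m => IsComonHom.hom_counit (g m).hom
  · exact NRep.hom_ext fun m => IsComonHom.hom_comul (g m).hom
  · exact NRep.hom_ext hg
  · intro g' hg'
    refine Comon.Hom.ext (NRep.hom_ext fun m => ?_)
    exact congrArg Comon.Hom.hom (hu m (homComponent g' m) (congrArg (fun f => Hom.app f m) hg'))

end

end NRepresentations

end

theorem propositionp17 (k : Type u) [Field k] {n : ℕ} (Q : Fin (n + 1) → Type v)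
    [∀ m, Quiver.{w} (Q m)] :
    (∀ m, (Comon.forget (NRepresentations.QRep k (Q m))).IsLeftAdjoint) ∧
    ∀ (V : ∀ m, NRepresentations.QRep k (Q m) ⥤ Comon (NRepresentations.QRep k (Q m)))
      (adj : ∀ m, Comon.forget (NRepresentations.QRep k (Q m)) ⊣ V m)
      (M : NRepresentations.NRep k Q),
      ∃ (ψ' : NRepresentations.Conn fun m => ((V m).obj (M.rep m)).X)
        (hψ' : NRepresentations.NRep.IsCoalgConn (fun m => (V m).obj (M.rep m)) ψ')
        (hp : ψ'.Compatible M.conn fun m => (adj m).counit.app (M.rep m)),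
        NRepresentations.IsCofree (Comon.forget (NRepresentations.NRep k Q)) M
          (NRepresentations.NRep.coalg (fun m => (V m).obj (M.rep m)) ψ' hψ')
          ⟨fun m => (adj m).counit.app (M.rep m), hp⟩ ∧
        ∀ χ : NRepresentations.Conn fun m => ((V m).obj (M.rep m)).X,
          NRepresentations.NRep.IsCoalgConn (fun m => (V m).obj (M.rep m)) χ →
          χ.Compatible M.conn (fun m => (adj m).counit.app (M.rep m)) →
          χ = ψ' := by
  refine ⟨fun m => NRepresentations.isLeftAdjoint_of_isCofree fun X =>
    let ⟨A, p, h, _⟩ := NRepresentations.exists_isCofree X; ⟨A, p, h⟩, fun V adj M => ?_⟩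
  have h₁ : ∀ m, NRepresentations.IsCofree (Comon.forget (NRepresentations.QRep k (Q m)))
      (M.rep m) ((V m).obj (M.rep m)) ((adj m).counit.app (M.rep m)) :=
    fun m => NRepresentations.isCofree_of_adjunction (adj m) (M.rep m)
  have h := fun m (i : Q m) => (h₁ m).pointwise ((Paths.of (Q m)).obj i)
  obtain ⟨ψ, hψ, hψp⟩ := NRepresentations.exists_conn h
  exact ⟨ψ, hψ, hψp, NRepresentations.isCofree_coalg h₁ h hψ hψp,
    fun χ hχ hχp => NRepresentations.conn_unique h hψ hψp hχ hχp⟩
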